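/- Let $P=(X,\prec)$ be a finite poset with $|X|=n\ge 2$ elements, and let $A\subseteq X$ be a nonempty subset. A linear extension of $P$ is a bijection $f:X\to\{1,\dots,n\}$ such that $f(x)<f(y)$ whenever $x\prec y$; for such $f$ put $f(A)=\{f(x):x\in A\}$. Let $\mathbf{P}$ denote probability with respect to a uniformly random linear extension $f$ of $P$. Then $$\mathbf{P}\big[1\in f(A),\ 2\notin f(A)\big]^2\ \ge\ \mathbf{P}\big[1\in f(A),\ 2\in f(A)\big]\cdot\mathbf{P}\big[1\notin f(A),\ 2\notin f(A)\big].$$ -/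

import Mathlib

namespace PosetCorr

/-- A linear extension of a finite poset `X` with `n` elements: a bijection
`f : X → {1, …, n}` with `f x < f y` whenever `x < y`. -/
abbrev LinExt (X : Type*) [PartialOrder X] [Fintype X] :=
  {f : X ≃ Finset.Icc 1 (Fintype.card X) // ∀ x y : X, x < y → f x < f y}

variable {X : Type*} [PartialOrder X] [Fintype X]

/-- There are only finitely many linear extensions. -/
instance : Finite (LinExt X) := by
  classical infer_instance

/-- Every finite poset has a linear extension, so that the uniform distribution makes sense. -/
instance : Nonempty (LinExt X) := by
  classical
  let i : Fintype (LinearExtension X) := (inferInstance : Fintype X)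
  let e : Fin (Fintype.card X) ≃o LinearExtension X := Fintype.orderIsoFinOfCardEq _ rfl
  let g : Fin (Fintype.card X) ≃ Finset.Icc 1 (Fintype.card X) :=
    { toFun := fun k => ⟨k + 1, by simp⟩
      invFun := fun k => ⟨k - 1, by have := Finset.mem_Icc.1 k.2; omega⟩
      left_inv := fun k => by simp
      right_inv := fun k => by
        have := Finset.mem_Icc.1 k.2
        ext
        simp
        omega }
  let t : X ≃ LinearExtension X := Equiv.refl X
  refine ⟨⟨(t.trans e.symm.toEquiv).trans g, fun x y h => ?_⟩⟩
  have h1 : t x < t y :=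
    lt_of_le_of_ne ((toLinearExtension (α := X)).monotone h.le) h.ne
  have h2 : e.symm (t x) < e.symm (t y) := e.symm.strictMono h1
  have h3 : (e.symm (t x) : ℕ) < e.symm (t y) := h2
  exact Subtype.mk_lt_mk.2 (Nat.succ_lt_succ h3)

/-- The set of values `f(A) = {f x : x ∈ A}`, a subset of `{1, …, n}`. -/
def values (f : LinExt X) (A : Set X) : Set ℕ :=
  {k | ∃ x ∈ A, (f.1 x : ℕ) = k}

/-- The probability of the event `E` for a uniformly random linear extension `f` of `X`. -/
noncomputable def prob (E : LinExt X → Prop) : ℝ :=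
  (Nat.card {f : LinExt X // E f} : ℝ) / (Nat.card (LinExt X) : ℝ)

end PosetCorr

/-! Linear extensions are words whose letters are minimal when removed. On the minimal elements of
`S`, let M(x,y) for x ≠ y count the extensions starting with xy, and let M(x,x) count those starting
with x and then a letter not minimal in `S`. M is symmetric, its row sums d(x) count the extensions
starting with x, and `quad S` is its quadratic form. The core is the reverse Cauchy inequality
`quad_mul_extCount_le`, Q(f)·(Σ d) ≤ (Σ f d)², proved by induction on `S`. The hypothesis for each
`S.erase x`, together with `quad_le_sum_quad`, gives M ≤ M D⁻¹ M. Hence every positive eigenvalue of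
D⁻¹M is at least 1; row-stochasticity bounds it by 1, and positive off-diagonal entries leave only
constant eigenvectors. So M is nonpositive on the d-orthogonal complement of the constants
(`quadratic_mul_sum_le_sq`). Taking f to be the indicator of A and exchanging incomparable first
letters yields the theorem (`firstTwo_mul_le_sq`). -/

namespace PosetCorr

/-! ### Spectral trickling down for symmetric matrices -/

section Spectral

open Finset Matrix

variable {ι : Type*} [Fintype ι]

/-- The Laplacian identity for a symmetric matrix with row sums `d`. -/
theorem sum_mul_sq_sub_quadratic {M : Matrix ι ι ℝ} {d : ι → ℝ} (hM : ∀ x y, M x y = M y x)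
    (hd : ∀ x, ∑ y, M x y = d x) (f : ι → ℝ) :
    ∑ x, ∑ y, M x y * (f x - f y) ^ 2 =
      2 * (∑ x, d x * f x ^ 2 - ∑ x, f x * ∑ y, M x y * f y) := by
  have h1 : ∑ x, ∑ y, M x y * f x ^ 2 = ∑ x, d x * f x ^ 2 := by
    simp_rw [← Finset.sum_mul, hd]
  have h2 : ∑ x, ∑ y, M x y * f y ^ 2 = ∑ x, d x * f x ^ 2 := by
    rw [Finset.sum_comm, ← h1]
    exact sum_congr rfl fun x _ => sum_congr rfl fun y _ => by rw [hM]
  have h3 : ∑ x, ∑ y, M x y * (f x - f y) ^ 2 =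
      ∑ x, ∑ y, M x y * f x ^ 2 + ∑ x, ∑ y, M x y * f y ^ 2
        - 2 * ∑ x, f x * ∑ y, M x y * f y := by
    simp_rw [Finset.mul_sum, ← Finset.sum_add_distrib, ← Finset.sum_sub_distrib]
    exact sum_congr rfl fun x _ => sum_congr rfl fun y _ => by ring
  rw [h3, h1, h2]
  ring

/-- An eigenvector of `M` relative to the row sums `d`, for a positive eigenvalue, is constant
as soon as `M ≤ M D⁻¹ M`. -/
theorem constant_of_eigenvalue_pos {M : Matrix ι ι ℝ} {d : ι → ℝ}
    (hM : ∀ x y, M x y = M y x) (hd : ∀ x, ∑ y, M x y = d x) (hd0 : ∀ x, 0 < d x)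
    (hpos : ∀ x y, x ≠ y → 0 < M x y)
    (h : ∀ f : ι → ℝ, ∑ x, f x * ∑ y, M x y * f y ≤ ∑ x, (∑ y, M x y * f y) ^ 2 / d x)
    {f : ι → ℝ} {c : ℝ} (hf : ∀ x, ∑ y, M x y * f y = c * (d x * f x)) (hc : 0 < c) (x y : ι) :
    f x = f y := by
  have hQ : ∑ x, f x * ∑ y, M x y * f y = c * ∑ x, d x * f x ^ 2 := by
    rw [mul_sum]
    exact sum_congr rfl fun x _ => by rw [hf]; ring
  have hR : ∑ x, (∑ y, M x y * f y) ^ 2 / d x = c ^ 2 * ∑ x, d x * f x ^ 2 := by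
    rw [mul_sum]
    refine sum_congr rfl fun x _ => ?_
    rw [hf]
    have := (hd0 x).ne'
    field_simp
  have hL := sum_mul_sq_sub_quadratic hM hd f
  -- Diagonal entries may have any sign: their terms vanish.
  have hN : ∀ x y, 0 ≤ M x y * (f x - f y) ^ 2 := fun x y => by
    rcases eq_or_ne x y with rfl | hxy
    · simp
    · exact mul_nonneg (hpos x y hxy).le (sq_nonneg _)
  have hE : 0 ≤ ∑ x, d x * f x ^ 2 := sum_nonneg fun x _ => mul_nonneg (hd0 x).le (sq_nonneg _)
  have hL0 : 0 ≤ ∑ x, ∑ y, M x y * (f x - f y) ^ 2 :=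
    sum_nonneg fun x _ => sum_nonneg fun y _ => hN x y
  have hf' := h f
  rw [hQ, hR] at hf'
  rw [hQ] at hL
  have hzero : ∑ x, ∑ y, M x y * (f x - f y) ^ 2 = 0 := by
    refine le_antisymm ?_ hL0
    rw [hL]
    -- The hypothesis reads cE ≤ c²E with E = Σ d f², while the Laplacian sum is 2(1 - c)E ≥ 0; as c
    -- > 0, both force it to vanish.
    have : c * ((1 - c) * ∑ x, d x * f x ^ 2) ≤ 0 := by nlinarith
    nlinarith [nonpos_of_mul_nonpos_right this hc]
  have h1 := (sum_eq_zero_iff_of_nonneg fun x _ => sum_nonneg fun y _ => hN x y).1 hzero x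
    (mem_univ x)
  have h2 := (sum_eq_zero_iff_of_nonneg fun y _ => hN x y).1 h1 y (mem_univ y)
  by_contra hne
  have hxy : x ≠ y := fun e => hne (e ▸ rfl)
  rcases mul_eq_zero.1 h2 with h3 | h3
  · exact (hpos x y hxy).ne' h3
  · exact hne (sub_eq_zero.1 (pow_eq_zero_iff two_ne_zero |>.1 h3))

/-- A symmetric matrix with positive row sums `d`, positive off-diagonal entries and
`M ≤ M D⁻¹ M` is negative semidefinite on the vectors orthogonal to `d`. -/
theorem quadratic_nonpos_of_orthogonal {M : Matrix ι ι ℝ} {d : ι → ℝ}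
    (hM : ∀ x y, M x y = M y x) (hd : ∀ x, ∑ y, M x y = d x) (hd0 : ∀ x, 0 < d x)
    (hpos : ∀ x y, x ≠ y → 0 < M x y)
    (h : ∀ f : ι → ℝ, ∑ x, f x * ∑ y, M x y * f y ≤ ∑ x, (∑ y, M x y * f y) ^ 2 / d x)
    {g : ι → ℝ} (hg : ∑ x, g x * d x = 0) : ∑ x, g x * ∑ y, M x y * g y ≤ 0 := by
  classical
  -- Conjugating D⁻¹M by D^(1/2) gives the symmetric matrix `B`, which has an orthonormal
  -- eigenbasis; `g` becomes `u` = D^(1/2) g.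
  set r : ι → ℝ := fun x => √(d x) with hr
  have hr0 : ∀ x, 0 < r x := fun x => Real.sqrt_pos.2 (hd0 x)
  have hrr : ∀ x, r x * r x = d x := fun x => Real.mul_self_sqrt (hd0 x).le
  set B : Matrix ι ι ℝ := Matrix.of fun x y => M x y / (r x * r y) with hB
  have hBh : B.IsHermitian := by
    ext x y
    simp [hB, hM y x, mul_comm]
  let u : EuclideanSpace ℝ ι := WithLp.toLp 2 fun x => r x * g x
  let b := hBh.eigenvectorBasis
  have hb : ∀ i x, ∑ y, B x y * b i y = hBh.eigenvalues i * b i x := fun i x => by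
    have := congrFun (hBh.mulVec_eigenvectorBasis i) x
    simpa [Matrix.mulVec, dotProduct] using this
  have hM' : ∀ x y, M x y = r x * B x y * r y := fun x y => by
    have := (hr0 x).ne'
    have := (hr0 y).ne'
    simp only [hB, Matrix.of_apply]
    field_simp
  let w : EuclideanSpace ℝ ι := WithLp.toLp 2 fun x => ∑ y, B x y * u y
  have hQ : ∑ x, g x * ∑ y, M x y * g y = inner ℝ u w := by
    simp only [PiLp.inner_apply, u, w, RCLike.inner_apply, conj_trivial, hM']
    refine sum_congr rfl fun x _ => ?_
    rw [mul_sum, sum_mul]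
    exact sum_congr rfl fun y _ => by ring
  have hw : ∀ i, inner ℝ (b i) w = hBh.eigenvalues i * inner ℝ u (b i) := fun i => by
    simp only [PiLp.inner_apply, w, RCLike.inner_apply, conj_trivial, mul_sum, sum_mul]
    rw [Finset.sum_comm]
    refine sum_congr rfl fun y _ => ?_
    have := hb i y
    calc ∑ x, B x y * u y * b i x = (∑ x, B y x * b i x) * u y := by
          rw [sum_mul]
          refine sum_congr rfl fun x _ => ?_
          have : B x y = B y x := by simpa using hBh.apply y x
          rw [this]; ring
      _ = _ := by rw [this]; ring
  rw [hQ, ← b.sum_inner_mul_inner u w]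
  refine sum_nonpos fun i _ => ?_
  rw [hw]
  rcases le_or_gt (hBh.eigenvalues i) 0 with hi | hi
  · nlinarith [mul_self_nonneg (inner ℝ u (b i))]
  -- A positive eigenvalue has eigenvector proportional to D^(1/2)·1, and `u` is orthogonal to it by
  -- `hg`.
  · have hconst := constant_of_eigenvalue_pos hM hd hd0 hpos h (f := fun x => b i x / r x)
      (c := hBh.eigenvalues i) (fun x => by
        have h1 : ∑ y, M x y * (b i y / r y) = r x * ∑ y, B x y * b i y := by
          rw [mul_sum]
          refine sum_congr rfl fun y _ => ?_
          have := (hr0 y).ne'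
          rw [hM']
          field_simp
        rw [h1, hb, ← hrr]
        have := (hr0 x).ne'
        field_simp) hi
    have h0 : inner ℝ u (b i) = 0 := by
      rcases isEmpty_or_nonempty ι with hι | ⟨⟨z⟩⟩
      · simp [PiLp.inner_apply]
      · simp only [PiLp.inner_apply, u, RCLike.inner_apply, conj_trivial]
        calc ∑ x, b i x * (r x * g x) = (b i z / r z) * ∑ x, g x * d x := by
              rw [mul_sum]
              refine sum_congr rfl fun x _ => ?_
              have := (hr0 x).ne'
              rw [hconst z x, ← hrr]
              field_simp
          _ = 0 := by rw [hg, mul_zero]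
    simp [h0]

/-- Trickling down: a symmetric matrix with positive row sums `d`, positive off-diagonal entries
and `M ≤ M D⁻¹ M` satisfies the reverse Cauchy inequality against the constant vector. -/
theorem quadratic_mul_sum_le_sq {M : Matrix ι ι ℝ} {d : ι → ℝ}
    (hM : ∀ x y, M x y = M y x) (hd : ∀ x, ∑ y, M x y = d x) (hd0 : ∀ x, 0 < d x)
    (hpos : ∀ x y, x ≠ y → 0 < M x y)
    (h : ∀ f : ι → ℝ, ∑ x, f x * ∑ y, M x y * f y ≤ ∑ x, (∑ y, M x y * f y) ^ 2 / d x)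
    (f : ι → ℝ) : (∑ x, f x * ∑ y, M x y * f y) * ∑ x, d x ≤ (∑ x, f x * d x) ^ 2 := by
  rcases isEmpty_or_nonempty ι with hι | hι
  · simp
  have hD : 0 < ∑ x, d x := sum_pos (fun x _ => hd0 x) univ_nonempty
  -- The d-weighted mean of `f`, so that f - c is orthogonal to d.
  set c := (∑ x, f x * d x) / ∑ x, d x with hc
  have hcD : c * ∑ x, d x = ∑ x, f x * d x := div_mul_cancel₀ _ hD.ne'
  have hg : ∑ x, (f x - c) * d x = 0 := by
    simp_rw [sub_mul, Finset.sum_sub_distrib, ← mul_sum, hcD, sub_self]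
  have hM1 : ∀ x, ∑ y, M x y * (f y - c) = (∑ y, M x y * f y) - c * d x := fun x => by
    simp_rw [mul_sub, Finset.sum_sub_distrib, ← sum_mul, hd, mul_comm c]
  have hsum : ∑ x, ∑ y, M x y * f y = ∑ x, f x * d x := by
    rw [Finset.sum_comm]
    refine sum_congr rfl fun y _ => ?_
    rw [← sum_mul, ← hd y, mul_comm]
    congr 1
    exact sum_congr rfl fun x _ => hM x y
  have hle := quadratic_nonpos_of_orthogonal hM hd hd0 hpos h hg
  have hexp : ∑ x, (f x - c) * ∑ y, M x y * (f y - c) =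
      ∑ x, f x * ∑ y, M x y * f y - c * ∑ x, f x * d x := by
    have : ∀ x, (f x - c) * ∑ y, M x y * (f y - c) =
        f x * (∑ y, M x y * f y) - c * (∑ y, M x y * f y) - c * ((f x - c) * d x) := fun x => by
      rw [hM1]; ring
    simp_rw [this, Finset.sum_sub_distrib, ← mul_sum, hg, hsum]
    ring
  rw [hexp, ← hcD] at hle
  rw [← hcD]
  nlinarith

end Spectral

/-! ### Linear extensions as words of successive minimal elements -/

noncomputable section Words

open Finset
open scoped Classical

variable {X : Type*} [PartialOrder X]

/-- The minimal elements of the subposet `S`. -/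
def minimals (S : Finset X) : Finset X := S.filter fun x => ∀ b ∈ S, ¬ b < x

/-- The words `x₁ … x_k` obtained by successively removing minimal elements from `S`. -/
def words : ℕ → Finset X → Finset (List X)
  | 0, _ => {[]}
  | k + 1, S => (minimals S).biUnion fun x => (words k (S.erase x)).image (List.cons x)

/-- The number of linear extensions of the subposet `S`. -/
def extCount (S : Finset X) : ℝ := #(words #S S)

theorem mem_minimals {S : Finset X} {x : X} :
    x ∈ minimals S ↔ x ∈ S ∧ ∀ b ∈ S, ¬ b < x := by
  simp [minimals]

theorem minimals_subset (S : Finset X) : minimals S ⊆ S := filter_subset _ _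

theorem minimals_nonempty {S : Finset X} (hS : S.Nonempty) : (minimals S).Nonempty := by
  obtain ⟨m, hm⟩ := S.exists_minimal hS
  exact ⟨m, mem_minimals.2 ⟨hm.1, fun b hb hlt => hlt.not_ge (hm.2 hb hlt.le)⟩⟩

theorem mem_minimals_erase {S : Finset X} {x y : X} (hy : y ∈ minimals S) (hxy : y ≠ x) :
    y ∈ minimals (S.erase x) := by
  rw [mem_minimals] at hy ⊢
  exact ⟨mem_erase.2 ⟨hxy, hy.1⟩, fun b hb => hy.2 b (mem_of_mem_erase hb)⟩

/-- Since x ≠ y, every element of `S` survives in one of the two deletions, so nothing in `S` lies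
below `w`. -/
theorem mem_minimals_of_erase_of_erase {S : Finset X} {x y w : X} (hxy : x ≠ y)
    (hx : w ∈ minimals (S.erase x)) (hy : w ∈ minimals (S.erase y)) : w ∈ minimals S := by
  rw [mem_minimals] at hx hy ⊢
  refine ⟨mem_of_mem_erase hx.1, fun b hb => ?_⟩
  rcases eq_or_ne b x with rfl | hbx
  · exact hy.2 b (mem_erase.2 ⟨hxy, hb⟩)
  · exact hx.2 b (mem_erase.2 ⟨hbx, hb⟩)

theorem sum_words_succ (k : ℕ) (S : Finset X) (φ : List X → ℝ) :
    ∑ l ∈ words (k + 1) S, φ l =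
      ∑ x ∈ minimals S, ∑ l ∈ words k (S.erase x), φ (x :: l) := by
  rw [words, sum_biUnion]
  · refine sum_congr rfl fun x _ => ?_
    rw [sum_image]
    intro a _ b _ h
    exact List.cons_injective h
  · intro x _ y _ hxy
    simp only [Function.onFun]
    rw [disjoint_left]
    intro l h1 h2
    obtain ⟨a, _, rfl⟩ := mem_image.1 h1
    obtain ⟨b, _, h⟩ := mem_image.1 h2
    exact hxy (List.cons.inj h).1.symm

theorem mem_words {k : ℕ} {S : Finset X} (hS : #S = k) {l : List X} :
    l ∈ words k S ↔ l.Nodup ∧ (∀ x, x ∈ l ↔ x ∈ S) ∧ l.Pairwise fun a b => ¬ b < a := by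
  induction k generalizing S l with
  | zero =>
    rw [card_eq_zero] at hS
    subst hS
    simp only [words, mem_singleton, notMem_empty, iff_false]
    constructor
    · rintro rfl
      simp
    · rintro ⟨-, h, -⟩
      exact List.eq_nil_iff_forall_not_mem.2 h
  | succ k ih =>
    simp only [words, mem_biUnion, mem_image]
    constructor
    · rintro ⟨x, hx, t, ht, rfl⟩
      rw [mem_minimals] at hx
      obtain ⟨h1, h2, h3⟩ := (ih (by rw [card_erase_of_mem hx.1, hS]; rfl)).1 ht
      refine ⟨List.nodup_cons.2 ⟨fun h => by simpa using (h2 x).1 h, h1⟩, fun y => ?_,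
        List.pairwise_cons.2 ⟨fun b hb => hx.2 b (mem_of_mem_erase ((h2 b).1 hb)), h3⟩⟩
      rw [List.mem_cons, h2, mem_erase]
      constructor
      · rintro (rfl | h)
        · exact hx.1
        · exact h.2
      · intro h
        by_cases hyx : y = x
        · exact Or.inl hyx
        · exact Or.inr ⟨hyx, h⟩
    · rintro ⟨h1, h2, h3⟩
      cases l with
      | nil =>
        obtain ⟨x, hx⟩ : S.Nonempty := card_pos.1 (by omega)
        exact absurd ((h2 x).2 hx) (by simp)
      | cons x t =>
        have hxS : x ∈ S := (h2 x).1 (by simp)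
        rw [List.nodup_cons] at h1
        rw [List.pairwise_cons] at h3
        refine ⟨x, mem_minimals.2 ⟨hxS, fun b hb hlt => ?_⟩, t, ?_, rfl⟩
        · rcases List.mem_cons.1 ((h2 b).2 hb) with rfl | hbt
          · exact lt_irrefl _ hlt
          · exact h3.1 b hbt hlt
        · refine (ih (by rw [card_erase_of_mem hxS, hS]; rfl)).2 ⟨h1.2, fun y => ?_, h3.2⟩
          rw [mem_erase, ← h2, List.mem_cons]
          constructor
          · intro h
            exact ⟨fun e => h1.1 (e ▸ h), Or.inr h⟩
          · rintro ⟨h, h' | h'⟩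
            · exact absurd h' h
            · exact h'

theorem extCount_eq_sum {S : Finset X} (hS : S.Nonempty) :
    extCount S = ∑ x ∈ minimals S, extCount (S.erase x) := by
  obtain ⟨k, hk⟩ : ∃ k, #S = k + 1 := ⟨#S - 1, by have := card_pos.2 hS; omega⟩
  have := sum_words_succ k S fun _ => 1
  simp only [sum_const, nsmul_eq_mul, mul_one] at this
  rw [extCount, hk, this]
  refine sum_congr rfl fun x hx => ?_
  rw [extCount, card_erase_of_mem (minimals_subset S hx), hk]
  rfl

theorem extCount_pos (S : Finset X) : 0 < extCount S := by
  induction S using Finset.strongInduction with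
  | H S ih =>
    rcases S.eq_empty_or_nonempty with rfl | hS
    · simp [extCount, words]
    · rw [extCount_eq_sum hS]
      exact sum_pos (fun x hx => ih _ (erase_ssubset (minimals_subset S hx)))
        (minimals_nonempty hS)

end Words

/-! ### The reverse Cauchy inequality by induction on the poset -/

noncomputable section Atlas

open Finset
open scoped Classical

theorem sum_sum_sum_nonneg_of_perm {X : Type*} (S : Finset X) (F : X → X → X → ℝ)
    (h : ∀ x ∈ S, ∀ y ∈ S, ∀ z ∈ S,
      0 ≤ F x y z + F x z y + F y x z + F y z x + F z x y + F z y x) :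
    0 ≤ ∑ x ∈ S, ∑ y ∈ S, ∑ z ∈ S, F x y z := by
  have h1 : 0 ≤ ∑ x ∈ S, ∑ y ∈ S, ∑ z ∈ S,
      (F x y z + F x z y + F y x z + F y z x + F z x y + F z y x) :=
    sum_nonneg fun x hx => sum_nonneg fun y hy => sum_nonneg fun z hz => h x hx y hy z hz
  have e1 : ∑ x ∈ S, ∑ y ∈ S, ∑ z ∈ S, F x z y = ∑ x ∈ S, ∑ y ∈ S, ∑ z ∈ S, F x y z :=
    sum_congr rfl fun x _ => Finset.sum_comm
  have e2 : ∑ x ∈ S, ∑ y ∈ S, ∑ z ∈ S, F y x z = ∑ x ∈ S, ∑ y ∈ S, ∑ z ∈ S, F x y z :=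
    Finset.sum_comm
  have e3 : ∑ x ∈ S, ∑ y ∈ S, ∑ z ∈ S, F y z x = ∑ x ∈ S, ∑ y ∈ S, ∑ z ∈ S, F x y z := by
    rw [Finset.sum_comm]
    exact sum_congr rfl fun x _ => Finset.sum_comm
  have e4 : ∑ x ∈ S, ∑ y ∈ S, ∑ z ∈ S, F z x y = ∑ x ∈ S, ∑ y ∈ S, ∑ z ∈ S, F x y z := by
    rw [← e3]
    refine Eq.trans ?_ (sum_congr rfl fun x _ => sum_congr rfl fun y _ => rfl)
    rw [e3, Finset.sum_congr rfl fun x _ => Finset.sum_comm, Finset.sum_comm]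
  have e5 : ∑ x ∈ S, ∑ y ∈ S, ∑ z ∈ S, F z y x = ∑ x ∈ S, ∑ y ∈ S, ∑ z ∈ S, F x y z := by
    rw [Finset.sum_comm, Finset.sum_congr rfl fun x _ => Finset.sum_comm, Finset.sum_comm]
  simp_rw [sum_add_distrib] at h1
  linarith

variable {X : Type*} [PartialOrder X]

/-- The minimal element of `S` that `y`, minimal in `S \ {x}`, is attributed to: `y` itself if it
is minimal in `S`, and `x` otherwise. -/
def root (S : Finset X) (x y : X) : X := if y ∈ minimals S then y else x

/-- The sum of `f` at the first letter over all linear extensions of `S`. -/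
def firstSum (S : Finset X) (f : X → ℝ) : ℝ := ∑ x ∈ minimals S, f x * extCount (S.erase x)

/-- The quadratic form of the first two letters, the second one replaced by its root. -/
def quad (S : Finset X) (f : X → ℝ) : ℝ :=
  ∑ x ∈ minimals S, f x * firstSum (S.erase x) fun y => f (root S x y)

theorem minimals_erase_filter_mem {S : Finset X} {x : X} :
    (minimals (S.erase x)).filter (· ∈ minimals S) = (minimals S).erase x := by
  ext y
  simp only [mem_filter, mem_erase]
  constructor
  · rintro ⟨h1, h2⟩
    exact ⟨(mem_erase.1 (minimals_subset _ h1)).1, h2⟩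
  · rintro ⟨h1, h2⟩
    exact ⟨mem_minimals_erase h2 h1, h2⟩

/-- The symmetric matrix of `quad S` on the minimal elements of `S`. -/
def rootMatrix (S : Finset X) : Matrix (minimals S) (minimals S) ℝ := Matrix.of fun x y =>
  if x = y then ∑ z ∈ (minimals (S.erase (x : X))).filter (· ∉ minimals S),
    extCount ((S.erase (x : X)).erase z)
  else extCount ((S.erase (x : X)).erase y)

theorem sum_rootMatrix_mul (S : Finset X) (f : X → ℝ) (x : minimals S) :
    ∑ y, rootMatrix S x y * f y =
      firstSum (S.erase (x : X)) fun y => f (root S x y) := by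
  rw [firstSum, ← sum_filter_add_sum_filter_not _ (· ∈ minimals S),
    minimals_erase_filter_mem, ← add_sum_erase _ _ (mem_univ x), add_comm]
  congr 1
  · have h : ∀ y ∈ (univ : Finset (minimals S)).erase x, rootMatrix S x y * f y =
        (fun y : X => extCount ((S.erase (x : X)).erase y) * f y) y := fun y hy => by
      have : x ≠ y := (ne_of_mem_erase hy).symm
      simp [rootMatrix, this]
    rw [sum_congr rfl h]
    refine sum_bij (fun y _ => (y : X)) ?_ ?_ ?_ ?_
    · intro y hy
      exact mem_erase.2 ⟨fun e => ne_of_mem_erase hy (Subtype.ext e), y.2⟩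
    · intro a _ b _ h
      exact Subtype.ext h
    · intro y hy
      exact ⟨⟨y, mem_of_mem_erase hy⟩, mem_erase.2
        ⟨fun e => ne_of_mem_erase hy (congrArg Subtype.val e), mem_univ _⟩, rfl⟩
    · intro y hy
      simp [root, mul_comm]
  · simp only [rootMatrix, Matrix.of_apply, if_true, sum_mul]
    refine sum_congr rfl fun y hy => ?_
    rw [root, if_neg (mem_filter.1 hy).2, mul_comm]

theorem firstSum_one {S : Finset X} (hS : S.Nonempty) : firstSum S (fun _ => 1) = extCount S := by
  simp [firstSum, extCount_eq_sum hS]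

/-- The reverse Cauchy inequality for `S` follows from its local version. -/
theorem quad_mul_extCount_le_of_local {S : Finset X} (hS : 2 ≤ #S)
    (h : ∀ f : X → ℝ, quad S f ≤
      ∑ x ∈ minimals S, firstSum (S.erase x) (fun y => f (root S x y)) ^ 2 / extCount (S.erase x))
    (f : X → ℝ) : quad S f * extCount S ≤ firstSum S f ^ 2 := by
  have hne : S.Nonempty := card_pos.1 (by omega)
  have hne' : ∀ x ∈ minimals S, (S.erase x).Nonempty := fun x hx => card_pos.1 (by
    rw [card_erase_of_mem (minimals_subset S hx)]; omega)
  have hquad : ∀ f : X → ℝ,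
      quad S f = ∑ x : minimals S, f x * ∑ y, rootMatrix S x y * f y := fun f => by
    simp_rw [sum_rootMatrix_mul]
    rw [quad, ← sum_coe_sort]
  have key := quadratic_mul_sum_le_sq (M := rootMatrix S)
    (d := fun x : minimals S => extCount (S.erase (x : X)))
    (fun x y => by
      rcases eq_or_ne x y with rfl | hxy
      · rfl
      · simp [rootMatrix, hxy, hxy.symm, erase_right_comm])
    (fun x => by
      have := sum_rootMatrix_mul S (fun _ => 1) x
      rw [firstSum_one (hne' x x.2)] at this
      simpa using this)
    (fun x => extCount_pos _)
    (fun x y hxy => by simp [rootMatrix, hxy, extCount_pos])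
    (fun g => by
      -- Extension by zero is harmless: for minimal `x`, `root S x y` is always minimal in `S`, so
      -- only values there are used.
      have hg : ∀ x : minimals S,
          g x = (fun z : X => if hz : z ∈ minimals S then g ⟨z, hz⟩ else 0) x := fun x => by
        simp
      set g' : X → ℝ := fun z => if hz : z ∈ minimals S then g ⟨z, hz⟩ else 0
      have := h g'
      rw [hquad, ← sum_coe_sort (minimals S)] at this
      refine (le_of_eq ?_).trans (this.trans (le_of_eq ?_))
      · exact sum_congr rfl fun x _ => by
          rw [hg x]
          exact congrArg _ (sum_congr rfl fun y _ => by rw [hg y])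
      · exact sum_congr rfl fun x _ => by
          rw [← sum_rootMatrix_mul]
          exact congrArg (· ^ 2 / _) (sum_congr rfl fun y _ => by rw [hg y]))
    (fun x => f x)
  rw [hquad, extCount_eq_sum hne, firstSum, ← sum_coe_sort (minimals S),
    ← sum_coe_sort (minimals S)]
  exact key

theorem sum_minimals_eq {S T : Finset X} (h : T ⊆ S) (F : X → ℝ) :
    ∑ x ∈ minimals T, F x = ∑ x ∈ S, if x ∈ minimals T then F x else 0 := by
  rw [← sum_filter, filter_mem_eq_inter, inter_eq_right.2 ((minimals_subset T).trans h)]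

theorem sum_minimals_triple_eq (S : Finset X) (F : X → X → X → ℝ) :
    ∑ x ∈ minimals S, ∑ y ∈ minimals (S.erase x), ∑ z ∈ minimals ((S.erase x).erase y), F x y z =
      ∑ x ∈ S, ∑ y ∈ S, ∑ z ∈ S, if x ∈ minimals S then if y ∈ minimals (S.erase x) then
        if z ∈ minimals ((S.erase x).erase y) then F x y z else 0 else 0 else 0 := by
  rw [sum_minimals_eq subset_rfl]
  refine sum_congr rfl fun x _ => ?_
  split_ifs
  · rw [sum_minimals_eq (erase_subset x S)]
    refine sum_congr rfl fun y _ => ?_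
    split_ifs
    · exact sum_minimals_eq ((erase_subset _ _).trans (erase_subset _ _)) _
    · simp
  · simp

/-- The pointwise inequality behind `quad_le_sum_quad`: the letters `x, y, z`, the propositions
recording which of them are available at the start (`a`), after one (`b`) and after two letters
(`t`) have been removed. -/
theorem root_perm_nonneg (ax ay az bxy bxz byx byz bzx bzy tx ty tz : Prop) (fx fy fz : ℝ)
    (h1 : ax → byx ∧ bzx) (h2 : ay → bxy ∧ bzy) (h3 : az → bxz ∧ byz)
    (h4 : byx ∨ bzx → tx) (h5 : bxy ∨ bzy → ty) (h6 : bxz ∨ byz → tz)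
    (h7 : byx → bzx → ax) (h8 : bxy → bzy → ay) (h9 : bxz → byz → az) :
    let G : Prop → Prop → Prop → Prop → Prop → Prop → ℝ → ℝ → ℝ → ℝ :=
      fun ax ay az bxy bxz tz fx fy fz => if ax then if bxy then if tz then
        (if ay then fy else fx) * (if bxz then (if az then fz else fx) else
          (if ay then fy else fx)) - fx * (if ay then fy else fx) else 0 else 0 else 0
    0 ≤ G ax ay az bxy bxz tz fx fy fz + G ax az ay bxz bxy ty fx fz fy +
        G ay ax az byx byz tz fy fx fz + G ay az ax byz byx tx fy fz fx +
        G az ax ay bzx bzy ty fz fx fy + G az ay ax bzy bzx tx fz fy fx := by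
  intro G
  simp only [G]
  -- The six terms cancel, except when exactly two letters are minimal and the third becomes
  -- available only after both are removed; the sum is then the square of the difference of `f` at
  -- those two.
  by_cases ax <;> by_cases ay <;> by_cases az <;> (try simp_all) <;> (try split_ifs) <;>
    (try simp_all) <;> nlinarith [sq_nonneg (fx - fy), sq_nonneg (fx - fz), sq_nonneg (fy - fz)]

/-- The quadratic form of `S` is dominated by the sum of those of its one-letter deletions. -/
theorem quad_le_sum_quad {S : Finset X} (hS : 3 ≤ #S) (f : X → ℝ) :
    quad S f ≤ ∑ x ∈ minimals S, quad (S.erase x) fun y => f (root S x y) := by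
  -- Expanding by the third letter puts both sides over the same triples.
  have hL : quad S f = ∑ x ∈ minimals S, ∑ y ∈ minimals (S.erase x),
      ∑ z ∈ minimals ((S.erase x).erase y),
        f x * f (root S x y) * extCount (((S.erase x).erase y).erase z) := by
    refine sum_congr rfl fun x hx => ?_
    rw [firstSum, mul_sum]
    refine sum_congr rfl fun y hy => ?_
    rw [extCount_eq_sum (S := (S.erase x).erase y), ← mul_assoc, mul_sum]
    apply card_pos.1
    rw [card_erase_of_mem (minimals_subset _ hy), card_erase_of_mem (minimals_subset _ hx)]
    omega
  have hR : ∑ x ∈ minimals S, quad (S.erase x) (fun y => f (root S x y)) =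
      ∑ x ∈ minimals S, ∑ y ∈ minimals (S.erase x), ∑ z ∈ minimals ((S.erase x).erase y),
        f (root S x y) * f (root S x (root (S.erase x) y z)) *
          extCount (((S.erase x).erase y).erase z) := by
    refine sum_congr rfl fun x hx => sum_congr rfl fun y hy => ?_
    rw [firstSum, mul_sum]
    exact sum_congr rfl fun z hz => by rw [mul_assoc]
  rw [← sub_nonneg, hL, hR]
  simp_rw [← sum_sub_distrib, ← sub_mul]
  rw [sum_minimals_triple_eq]
  refine sum_sum_sum_nonneg_of_perm S _ fun x _ y _ z _ => ?_
  have hself : ∀ a : X, ∀ T : Finset X, a ∉ minimals (T.erase a) := fun a T h =>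
    notMem_erase a T (minimals_subset _ h)
  have hself' : ∀ a b : X, ∀ T : Finset X, a ∉ minimals ((T.erase a).erase b) := fun a b T h =>
    notMem_erase a T (mem_of_mem_erase (minimals_subset _ h))
  -- Triples with a repeated letter contribute nothing.
  rcases eq_or_ne x y with rfl | hxy
  · simp [hself, hself']
  rcases eq_or_ne x z with rfl | hxz
  · simp [hself, hself']
  rcases eq_or_ne y z with rfl | hyz
  · simp [hself, hself']
  have key := root_perm_nonneg (x ∈ minimals S) (y ∈ minimals S) (z ∈ minimals S)
    (y ∈ minimals (S.erase x)) (z ∈ minimals (S.erase x)) (x ∈ minimals (S.erase y))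
    (z ∈ minimals (S.erase y)) (x ∈ minimals (S.erase z)) (y ∈ minimals (S.erase z))
    (x ∈ minimals ((S.erase y).erase z)) (y ∈ minimals ((S.erase x).erase z))
    (z ∈ minimals ((S.erase x).erase y)) (f x) (f y) (f z)
    (fun h => ⟨mem_minimals_erase h hxy, mem_minimals_erase h hxz⟩)
    (fun h => ⟨mem_minimals_erase h hxy.symm, mem_minimals_erase h hyz⟩)
    (fun h => ⟨mem_minimals_erase h hxz.symm, mem_minimals_erase h hyz.symm⟩)
    (fun h => h.elim (fun h => mem_minimals_erase h hxz)
      fun h => by rw [erase_right_comm]; exact mem_minimals_erase h hxy)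
    (fun h => h.elim (fun h => mem_minimals_erase h hyz)
      fun h => by rw [erase_right_comm]; exact mem_minimals_erase h hxy.symm)
    (fun h => h.elim (fun h => mem_minimals_erase h hyz.symm)
      fun h => by rw [erase_right_comm]; exact mem_minimals_erase h hxz.symm)
    (mem_minimals_of_erase_of_erase hyz) (mem_minimals_of_erase_of_erase hxz)
    (mem_minimals_of_erase_of_erase hxy)
  have hroot : ∀ a b c : X, f (root S a (root (S.erase a) b c)) =
      if c ∈ minimals (S.erase a) then (if c ∈ minimals S then f c else f a) else
        (if b ∈ minimals S then f b else f a) := fun a b c => by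
    simp only [root]
    split_ifs <;> rfl
  have hroot' : ∀ a b : X, f (root S a b) = if b ∈ minimals S then f b else f a := fun a b => by
    simp only [root]
    split_ifs <;> rfl
  -- All six orders of a triple leave the same remainder, hence share this weight.
  have hc := (extCount_pos (((S.erase x).erase y).erase z)).le
  have key' := mul_nonneg key hc
  refine key'.trans (le_of_eq ?_)
  have q1 : (S.erase z).erase x = (S.erase x).erase z := erase_right_comm
  have q2 : (S.erase z).erase y = (S.erase y).erase z := erase_right_comm
  have q3 : (S.erase y).erase x = (S.erase x).erase y := erase_right_comm
  have q4 : ((S.erase x).erase z).erase y = ((S.erase x).erase y).erase z := erase_right_comm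
  have q5 : ((S.erase y).erase z).erase x = ((S.erase x).erase y).erase z := by
    rw [erase_right_comm, q3]
  simp only [hroot, hroot', add_mul, ite_mul, zero_mul, q1, q2, q3, q4, q5]
  congr!

theorem minimals_singleton (x : X) : minimals {x} = {x} := by
  ext y
  simp only [mem_minimals, mem_singleton, forall_eq, and_iff_left_iff_imp]
  rintro rfl
  exact lt_irrefl _

theorem extCount_empty : extCount (∅ : Finset X) = 1 := by
  simp [extCount, words]

theorem extCount_singleton (x : X) : extCount {x} = 1 := by
  rw [extCount_eq_sum (singleton_nonempty x), minimals_singleton, sum_singleton,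
    erase_singleton, extCount_empty]

theorem firstSum_singleton (x : X) (f : X → ℝ) : firstSum {x} f = f x := by
  rw [firstSum, minimals_singleton, sum_singleton, erase_singleton, extCount_empty, mul_one]

/-- Base case: for an antichain this is 2f(x)f(y) ≤ f(x)² + f(y)²; for a chain both sides agree. -/
theorem quad_le_of_card_eq_two {S : Finset X} (hS : #S = 2) (f : X → ℝ) : quad S f ≤
    ∑ x ∈ minimals S,
      firstSum (S.erase x) (fun y => f (root S x y)) ^ 2 / extCount (S.erase x) := by
  obtain ⟨x, y, hxy, rfl⟩ := card_eq_two.1 hS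
  have hx : ({x, y} : Finset X).erase x = {y} := erase_insert (by simpa using hxy)
  have hy : ({x, y} : Finset X).erase y = {x} := by
    rw [pair_comm]
    exact erase_insert (by simpa using hxy.symm)
  rw [quad, sum_minimals_eq subset_rfl, sum_minimals_eq subset_rfl, sum_pair hxy, sum_pair hxy,
    hx, hy]
  simp only [firstSum_singleton, extCount_singleton, root, div_one]
  split_ifs <;> nlinarith [sq_nonneg (f x - f y)]

/-- The reverse Cauchy inequality for the first two letters of linear extensions. -/
theorem quad_mul_extCount_le (S : Finset X) (hS : 2 ≤ #S) (f : X → ℝ) :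
    quad S f * extCount S ≤ firstSum S f ^ 2 := by
  induction S using Finset.strongInduction generalizing f with
  | H S ih =>
    refine quad_mul_extCount_le_of_local hS (fun f => ?_) f
    rcases hS.eq_or_lt with h2 | h3
    · exact quad_le_of_card_eq_two h2.symm f
    · refine (quad_le_sum_quad h3 f).trans (sum_le_sum fun x hx => ?_)
      rw [le_div_iff₀ (extCount_pos _)]
      refine ih _ (erase_ssubset (minimals_subset S hx)) ?_ _
      rw [card_erase_of_mem (minimals_subset S hx)]
      omega

end Atlas

/-! ### Events on the first two letters -/

noncomputable section FirstTwo

open Finset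
open scoped Classical

variable {X : Type*} [PartialOrder X]

/-- The number of linear extensions of `S` whose first two letters satisfy `ψ`. -/
def firstTwo (S : Finset X) (ψ : X → X → Prop) : ℝ :=
  ∑ x ∈ minimals S, ∑ y ∈ minimals (S.erase x), if ψ x y then extCount ((S.erase x).erase y) else 0

theorem firstTwo_nonneg (S : Finset X) (ψ : X → X → Prop) : 0 ≤ firstTwo S ψ :=
  sum_nonneg fun x _ => sum_nonneg fun y _ => by
    split_ifs
    exacts [(extCount_pos _).le, le_rfl]

theorem firstTwo_mono (S : Finset X) {ψ θ : X → X → Prop} (h : ∀ x y, ψ x y → θ x y) :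
    firstTwo S ψ ≤ firstTwo S θ :=
  sum_le_sum fun x _ => sum_le_sum fun y _ => by
    have := (extCount_pos ((S.erase x).erase y)).le
    split_ifs with h1 h2
    exacts [le_rfl, absurd (h x y h1) h2, this, le_rfl]

theorem firstTwo_split (S : Finset X) (ψ θ : X → X → Prop) :
    firstTwo S ψ =
      firstTwo S (fun x y => ψ x y ∧ θ x y) + firstTwo S (fun x y => ψ x y ∧ ¬ θ x y) := by
  simp only [firstTwo, ← sum_add_distrib]
  refine sum_congr rfl fun x _ => sum_congr rfl fun y _ => ?_
  by_cases ψ x y <;> by_cases θ x y <;> simp [*]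

theorem firstTwo_congr (S : Finset X) {ψ θ : X → X → Prop} (h : ∀ x y, ψ x y ↔ θ x y) :
    firstTwo S ψ = firstTwo S θ := by
  rw [show ψ = θ from funext fun x => funext fun y => propext (h x y)]

theorem firstTwo_minimal_eq (S : Finset X) {ψ : X → X → Prop} (hψ : ∀ x, ¬ ψ x x) :
    firstTwo S (fun x y => ψ x y ∧ y ∈ minimals S) =
      ∑ x ∈ minimals S, ∑ y ∈ minimals S,
        if ψ x y then extCount ((S.erase x).erase y) else 0 := by
  refine sum_congr rfl fun x _ => ?_
  rw [← sum_filter]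
  trans ∑ y ∈ minimals (S.erase x) with ψ x y ∧ y ∈ minimals S, extCount ((S.erase x).erase y)
  · rw [sum_filter]
    exact sum_congr rfl fun y _ => by congr
  refine sum_congr ?_ fun _ _ => rfl
  ext y
  simp only [mem_filter]
  constructor
  · rintro ⟨-, h1, h2⟩
    exact ⟨h2, h1⟩
  · rintro ⟨h1, h2⟩
    exact ⟨mem_minimals_erase h1 fun e => hψ x (e ▸ h2), h2, h1⟩

/-- Two letters that are both minimal may be exchanged. -/
theorem firstTwo_minimal_swap (S : Finset X) {ψ : X → X → Prop} (hψ : ∀ x, ¬ ψ x x) :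
    firstTwo S (fun x y => ψ x y ∧ y ∈ minimals S) =
      firstTwo S (fun x y => ψ y x ∧ y ∈ minimals S) := by
  rw [firstTwo_minimal_eq S hψ, firstTwo_minimal_eq S (ψ := fun x y => ψ y x) hψ, sum_comm]
  refine sum_congr rfl fun x _ => sum_congr rfl fun y _ => ?_
  rw [erase_right_comm]

theorem extCount_eq_firstTwo {S : Finset X} (hS : 2 ≤ #S) :
    extCount S = firstTwo S fun _ _ => True := by
  rw [extCount_eq_sum (card_pos.1 (by omega)), firstTwo]
  refine sum_congr rfl fun x hx => ?_
  rw [extCount_eq_sum (card_pos.1 (by rw [card_erase_of_mem (minimals_subset S hx)]; omega))]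
  simp

theorem firstSum_indicator {S : Finset X} (hS : 2 ≤ #S) (A : Set X) :
    firstSum S (fun x => if x ∈ A then 1 else 0) = firstTwo S fun x _ => x ∈ A := by
  refine sum_congr rfl fun x hx => ?_
  rw [extCount_eq_sum (card_pos.1 (by rw [card_erase_of_mem (minimals_subset S hx)]; omega))]
  by_cases x ∈ A <;> simp [*]

/-- A second letter that is not minimal in `S` is attributed to `x`, so it counts as lying in `A`
whenever `x` does. -/
theorem quad_indicator (S : Finset X) (A : Set X) :
    quad S (fun x => if x ∈ A then 1 else 0) =
      firstTwo S fun x y => x ∈ A ∧ (y ∈ A ∨ y ∉ minimals S) := by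
  refine sum_congr rfl fun x _ => ?_
  rw [firstSum, mul_sum]
  refine sum_congr rfl fun y _ => ?_
  by_cases x ∈ A <;> by_cases y ∈ A <;> by_cases y ∈ minimals S <;> simp [root, *]

theorem firstTwo_mul_le_sq {S : Finset X} (hS : 2 ≤ #S) (A : Set X) :
    firstTwo S (fun x y => x ∈ A ∧ y ∈ A) * firstTwo S (fun x y => x ∉ A ∧ y ∉ A) ≤
      firstTwo S (fun x y => x ∈ A ∧ y ∉ A) ^ 2 := by
  have key := quad_mul_extCount_le S hS fun x => if x ∈ A then 1 else 0
  rw [quad_indicator, firstSum_indicator hS, extCount_eq_firstTwo hS,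
    firstTwo_split S (fun _ _ => True) fun x _ => x ∈ A] at key
  simp only [true_and] at key
  rw [firstTwo_split S (fun x _ => x ∈ A) fun _ y => y ∈ A,
    firstTwo_split S (fun x _ => x ∉ A) fun _ y => y ∈ A,
    firstTwo_split S (fun x y => x ∈ A ∧ (y ∈ A ∨ y ∉ minimals S)) fun _ y => y ∈ A] at key
  have h1 : firstTwo S (fun x y => (x ∈ A ∧ (y ∈ A ∨ y ∉ minimals S)) ∧ y ∈ A) =
      firstTwo S fun x y => x ∈ A ∧ y ∈ A := firstTwo_congr S fun x y => by tauto
  have h2 : firstTwo S (fun x y => (x ∈ A ∧ (y ∈ A ∨ y ∉ minimals S)) ∧ y ∉ A) =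
      firstTwo S fun x y => (x ∈ A ∧ y ∉ A) ∧ y ∉ minimals S := firstTwo_congr S fun x y => by tauto
  have h3 := firstTwo_split S (fun x y => x ∈ A ∧ y ∉ A) fun _ y => y ∈ minimals S
  have h4 := firstTwo_minimal_swap S (ψ := fun x y => x ∈ A ∧ y ∉ A) fun x h => h.2 h.1
  have h5 : firstTwo S (fun x y => (y ∈ A ∧ x ∉ A) ∧ y ∈ minimals S) ≤
      firstTwo S fun x y => x ∉ A ∧ y ∈ A := firstTwo_mono S fun x y h => ⟨h.1.2, h.1.1⟩
  rw [h1, h2, h3] at key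
  rw [h3]
  have p11 := firstTwo_nonneg S fun x y => x ∈ A ∧ y ∈ A
  have p00 := firstTwo_nonneg S fun x y => x ∉ A ∧ y ∉ A
  have ps := firstTwo_nonneg S fun x y => (x ∈ A ∧ y ∉ A) ∧ y ∈ minimals S
  have pa := firstTwo_nonneg S fun x y => (x ∈ A ∧ y ∉ A) ∧ y ∉ minimals S
  rw [← h4] at h5
  generalize firstTwo S (fun x y => x ∈ A ∧ y ∈ A) = a at *
  generalize firstTwo S (fun x y => x ∉ A ∧ y ∉ A) = b at *
  generalize firstTwo S (fun x y => x ∉ A ∧ y ∈ A) = c at *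
  generalize firstTwo S (fun x y => (x ∈ A ∧ y ∉ A) ∧ y ∈ minimals S) = s at *
  generalize firstTwo S (fun x y => (x ∈ A ∧ y ∉ A) ∧ y ∉ minimals S) = t at *
  -- `key` is (a+t)(a+s+t+b+c) ≤ (a+s+t)², that is (a+t)(b+c) ≤ s(a+s+t); then s ≤ c (`h5`) applies.
  -- The goal is ab ≤ (s+t)².
  have h6 : (a + t) * b ≤ s ^ 2 := by nlinarith [mul_nonneg (add_nonneg p11 pa) (sub_nonneg.2 h5)]
  nlinarith [mul_nonneg pa p00, mul_nonneg ps pa]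

end FirstTwo

/-! ### From words back to linear extensions and probabilities -/

noncomputable section Counting

open Finset
open scoped Classical

/-- The increasing enumeration of `{1, …, n}`. -/
def succEquiv (n : ℕ) : Fin n ≃ Finset.Icc 1 n where
  toFun k := ⟨k + 1, by simp⟩
  invFun k := ⟨k - 1, by have := Finset.mem_Icc.1 k.2; omega⟩
  left_inv k := by simp
  right_inv k := by
    have := Finset.mem_Icc.1 k.2
    ext
    simp
    omega

theorem succEquiv_lt_iff {n : ℕ} {i j : Fin n} : succEquiv n i < succEquiv n j ↔ i < j := by
  simp [succEquiv, ← Subtype.coe_lt_coe]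

variable {X : Type*} [PartialOrder X] [Fintype X]

/-- The elements of `X` listed in the order of a linear extension. -/
def LinExt.toList (f : LinExt X) : List X :=
  List.ofFn fun i => f.1.symm (succEquiv _ i)

theorem LinExt.toList_injective : Function.Injective (LinExt.toList (X := X)) := by
  intro f g h
  have h1 := List.ofFn_injective h
  have h2 : f.1.symm = g.1.symm := by
    ext k
    have := congrFun h1 ((succEquiv _).symm k)
    simpa using this
  refine Subtype.ext ?_
  rw [← Equiv.symm_symm f.1, h2, Equiv.symm_symm]

theorem LinExt.toList_mem_words (f : LinExt X) :
    f.toList ∈ words (Fintype.card X) (univ : Finset X) := by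
  rw [mem_words card_univ]
  refine ⟨?_, fun x => ?_, ?_⟩
  · rw [LinExt.toList, List.nodup_ofFn]
    exact f.1.symm.injective.comp (succEquiv _).injective
  · simp only [LinExt.toList, List.mem_ofFn, mem_univ, iff_true]
    exact ⟨(succEquiv _).symm (f.1 x), by simp⟩
  · rw [LinExt.toList, List.pairwise_ofFn]
    intro i j hij hlt
    have h := f.2 _ _ hlt
    simp only [Equiv.apply_symm_apply] at h
    exact lt_asymm h (succEquiv_lt_iff.2 hij)

theorem LinExt.exists_toList_eq {l : List X}
    (hl : l ∈ words (Fintype.card X) (univ : Finset X)) : ∃ f : LinExt X, f.toList = l := by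
  rw [mem_words card_univ] at hl
  obtain ⟨h1, h2, h3⟩ := hl
  let σ : Fin l.length ≃ X := h1.getEquivOfForallMemList l fun x => (h2 x).2 (mem_univ x)
  have hlen : l.length = Fintype.card X := by simpa using Fintype.card_congr σ
  have hσ : ∀ i, σ i = l[i] := fun i => rfl
  refine ⟨⟨σ.symm.trans ((finCongr hlen).trans (succEquiv _)), fun x y hxy => ?_⟩, ?_⟩
  · simp only [Equiv.trans_apply, succEquiv_lt_iff]
    have : σ.symm x < σ.symm y := by
      by_contra! hle
      rcases hle.eq_or_lt with he | hlt
      · exact hxy.ne' (σ.symm.injective he)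
      -- If y preceded x in the word, `h3` would forbid x < y.
      · have := List.pairwise_iff_getElem.1 h3 _ _ (σ.symm y).2 (σ.symm x).2 hlt
        have e : ∀ z, l[(σ.symm z : ℕ)] = z := fun z => by
          have := hσ (σ.symm z)
          rw [Equiv.apply_symm_apply] at this
          exact this.symm
        rw [e, e] at this
        exact this hxy
    exact this
  · refine List.ext_getElem (by simp [LinExt.toList, hlen]) fun i hi hi' => ?_
    simp only [LinExt.toList, List.getElem_ofFn, Equiv.symm_trans_apply, Equiv.symm_symm,
      Equiv.symm_apply_apply]
    rw [hσ]
    rfl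

theorem LinExt.toList_getElem? (f : LinExt X) (i : ℕ) (x : X) :
    f.toList[i]? = some x ↔ (f.1 x : ℕ) = i + 1 := by
  rw [List.getElem?_eq_some_iff]
  simp only [LinExt.toList, List.getElem_ofFn, List.length_ofFn]
  constructor
  · rintro ⟨h, rfl⟩
    simp [succEquiv]
  · intro h
    have h' : i < Fintype.card X := by
      have := Finset.mem_Icc.1 (f.1 x).2
      omega
    refine ⟨h', ?_⟩
    rw [Equiv.symm_apply_eq]
    exact Subtype.ext h.symm

/-- Counting linear extensions by their first two elements. -/
theorem card_linExt_first_two (hX : 2 ≤ Fintype.card X) (ψ : X → X → Prop) :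
    (Nat.card {f : LinExt X // ∃ x y, ψ x y ∧ (f.1 x : ℕ) = 1 ∧ (f.1 y : ℕ) = 2} : ℝ) =
      ∑ x ∈ minimals (univ : Finset X), ∑ y ∈ minimals (univ.erase x),
        if ψ x y then extCount (((univ : Finset X).erase x).erase y) else 0 := by
  let E : List X → Prop := fun l => ∃ x y, ψ x y ∧ l[0]? = some x ∧ l[1]? = some y
  have hE : ∀ f : LinExt X,
      (∃ x y, ψ x y ∧ (f.1 x : ℕ) = 1 ∧ (f.1 y : ℕ) = 2) ↔ E f.toList := fun f => by
    simp only [E, LinExt.toList_getElem?]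
  have himg : LinExt.toList '' {f : LinExt X | E f.toList} =
      ((words (Fintype.card X) (univ : Finset X)).filter E : Set (List X)) := by
    ext l
    simp only [Set.mem_image, Set.mem_ofPred_eq, coe_filter]
    constructor
    · rintro ⟨f, hf, rfl⟩
      exact ⟨f.toList_mem_words, hf⟩
    · rintro ⟨hl, h⟩
      obtain ⟨f, rfl⟩ := LinExt.exists_toList_eq hl
      exact ⟨f, h, rfl⟩
  have hcard : Nat.card {f : LinExt X // ∃ x y, ψ x y ∧ (f.1 x : ℕ) = 1 ∧ (f.1 y : ℕ) = 2} =
      #((words (Fintype.card X) (univ : Finset X)).filter E) := by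
    rw [← Set.ncard_coe_finset, ← himg, Set.ncard_image_of_injective _ LinExt.toList_injective,
      ← Nat.card_coe_set_eq]
    exact Nat.card_congr (Equiv.subtypeEquivRight hE)
  obtain ⟨k, hk⟩ : ∃ k, Fintype.card X = k + 2 := ⟨Fintype.card X - 2, by omega⟩
  rw [hcard, card_filter, hk]
  push_cast
  rw [sum_words_succ]
  refine sum_congr rfl fun x hx => ?_
  rw [sum_words_succ]
  refine sum_congr rfl fun y hy => ?_
  have hc : #(((univ : Finset X).erase x).erase y) = k := by
    rw [card_erase_of_mem (minimals_subset _ hy), card_erase_of_mem (mem_univ x), card_univ, hk]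
    rfl
  by_cases hψ : ψ x y <;> simp [hψ, extCount, hc]

theorem mem_values_iff (f : LinExt X) {A : Set X} {k : ℕ} {x : X} (hx : (f.1 x : ℕ) = k) :
    k ∈ values f A ↔ x ∈ A := by
  constructor
  · rintro ⟨y, hy, hyk⟩
    rwa [← f.1.injective (Subtype.ext (hyk.trans hx.symm))]
  · exact fun h => ⟨x, h, hx⟩

/-- The probability of an event that depends only on the first two elements. -/
theorem prob_eq_firstTwo (hX : 2 ≤ Fintype.card X) {E : LinExt X → Prop} {ψ : X → X → Prop}
    (h : ∀ (f : LinExt X) x y, (f.1 x : ℕ) = 1 → (f.1 y : ℕ) = 2 → (E f ↔ ψ x y)) :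
    prob E = firstTwo univ ψ / Nat.card (LinExt X) := by
  rw [prob, firstTwo, ← card_linExt_first_two hX]
  have : ∀ f : LinExt X, E f ↔ ∃ x y, ψ x y ∧ (f.1 x : ℕ) = 1 ∧ (f.1 y : ℕ) = 2 := fun f => by
    constructor
    · intro hE
      have h1 : (f.1 (f.1.symm ⟨1, by simp; omega⟩) : ℕ) = 1 := by simp
      have h2 : (f.1 (f.1.symm ⟨2, by simp; omega⟩) : ℕ) = 2 := by simp
      exact ⟨_, _, (h f _ _ h1 h2).1 hE, h1, h2⟩
    · rintro ⟨x, y, hψ, h1, h2⟩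
      exact (h f x y h1 h2).2 hψ
  rw [Nat.card_congr (Equiv.subtypeEquivRight this)]

end Counting

end PosetCorr

theorem corollaryc {X : Type*} [PartialOrder X] [Fintype X] (hX : 2 ≤ Fintype.card X)
    (A : Set X) (hA : A.Nonempty) :
    PosetCorr.prob (fun f : PosetCorr.LinExt X =>
        1 ∈ PosetCorr.values f A ∧ 2 ∉ PosetCorr.values f A) ^ 2 ≥
      PosetCorr.prob (fun f : PosetCorr.LinExt X =>
          1 ∈ PosetCorr.values f A ∧ 2 ∈ PosetCorr.values f A) *
        PosetCorr.prob (fun f : PosetCorr.LinExt X =>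
          1 ∉ PosetCorr.values f A ∧ 2 ∉ PosetCorr.values f A) := by
  rw [PosetCorr.prob_eq_firstTwo hX (ψ := fun x y => x ∈ A ∧ y ∉ A) fun f x y h1 h2 => by
      rw [PosetCorr.mem_values_iff f h1, PosetCorr.mem_values_iff f h2],
    PosetCorr.prob_eq_firstTwo hX (ψ := fun x y => x ∈ A ∧ y ∈ A) fun f x y h1 h2 => by
      rw [PosetCorr.mem_values_iff f h1, PosetCorr.mem_values_iff f h2],
    PosetCorr.prob_eq_firstTwo hX (ψ := fun x y => x ∉ A ∧ y ∉ A) fun f x y h1 h2 => by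
      rw [PosetCorr.mem_values_iff f h1, PosetCorr.mem_values_iff f h2],
    div_pow, div_mul_div_comm, ← pow_two, ge_iff_le]
  exact div_le_div_of_nonneg_right (PosetCorr.firstTwo_mul_le_sq (by simpa using hX) A)
    (sq_nonneg _)
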